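/- Let $G$ be a finite group. For $u,g\in G$ and a positive integer $n$ put $G_n(u,g)=\{a\in G : (au^{-1})^n=a^n=g\}$. Let $D(G)$ be the Drinfel'd double of $G$ over $\mathbb{C}$, with normalized integral $\Lambda$, and for a representation $V$ of $D(G)$ with character $\chi$ let $\nu_n(V)=\chi(\Lambda^{[n]})$ be its $n$-th Frobenius–Schur indicator, where $h^{[n]}=h_1h_2\cdots h_n$ in Sweedler notation. $G$ is called an $FSZ$-group if $\nu_n(V)\in\mathbb{Z}$ for every irreducible representation $V$ of $D(G)$ and every $n\ge 1$. $G$ is called an $FSZ^+$-group if for every $n\ge 1$, all commuting $u,g\in G$ and all integers $m$ with $\gcd(m,|G|)=1$, the sets $G_n(u,g)$ and $G_n(u,g^m)$, on which $C_G(u,g)$ (the subgroup of elements commuting with both $u$ and $g$) acts by conjugation, afford isomorphic complex permutation modules for $C_G(u,g)$. Then: 1. Every finite abelian group is an $FSZ$-group. 2. Every finite dihedral group (of order $2k$, $k\ge 1$) is an $FSZ$-group. 3. For every prime power $q\ge 2$, the centralizer of each nonidentity element of $PSL_2(q)$ is abelian or dihedral. 4. For every prime power $q\ge 2$, $PSL_2(q)$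 is an $FSZ^+$-group. -/

import Mathlib

open scoped TensorProduct

noncomputable section

/-- The underlying complex vector space of the Drinfel'd double `D(G)` of a group `G`:
it has a basis `e_g x`, indexed by the pairs `(g, x)` of elements of `G`. -/
def DrinfeldDouble (G : Type*) : Type _ := G × G →₀ ℂ

namespace DrinfeldDouble

variable {G : Type*}

instance : AddCommGroup (DrinfeldDouble G) := inferInstanceAs (AddCommGroup (G × G →₀ ℂ))

instance : Module ℂ (DrinfeldDouble G) := inferInstanceAs (Module ℂ (G × G →₀ ℂ))

/-- The basis vectors `e_g x`, as a basis indexed by `(g, x)`. -/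
def basis (G : Type*) : Module.Basis (G × G) ℂ (DrinfeldDouble G) :=
  Module.Basis.ofRepr (LinearEquiv.refl ℂ (G × G →₀ ℂ))

/-- The basis vector `e_g x` of `D(G)`. -/
def e (g x : G) : DrinfeldDouble G := basis G (g, x)

theorem hom_ext {M : Type*} [AddCommMonoid M] [Module ℂ M]
    {f k : DrinfeldDouble G →ₗ[ℂ] M} (h : ∀ g x, f (e g x) = k (e g x)) : f = k :=
  (basis G).ext fun p => h p.1 p.2

variable [Group G]

open Classical in
/-- The multiplication of `D(G)` as a bilinear map:
`(e_g x) (e_h y) = δ_{g, x h x⁻¹} e_g (x y)`. -/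
def mulHom (G : Type*) [Group G] :
    DrinfeldDouble G →ₗ[ℂ] DrinfeldDouble G →ₗ[ℂ] DrinfeldDouble G :=
  (basis G).constr ℂ fun p => (basis G).constr ℂ fun q =>
    if p.1 = p.2 * q.1 * p.2⁻¹ then e p.1 (p.2 * q.2) else 0

instance : Mul (DrinfeldDouble G) := ⟨fun a b => mulHom G a b⟩

theorem mul_def (a b : DrinfeldDouble G) : a * b = mulHom G a b := rfl

open Classical in
theorem e_mul_e (g x h y : G) :
    e g x * e h y = if g = x * h * x⁻¹ then e g (x * y) else 0 := by
  simp [mul_def, mulHom, e, Module.Basis.constr_basis]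

theorem mulHom_e (g x h y : G) : mulHom G (e g x) (e h y) = e g x * e h y := rfl

theorem mul_assoc_aux (a b c : DrinfeldDouble G) : a * b * c = a * (b * c) := by
  classical
  have : (mulHom G).compr₂ (mulHom G) =
      ((LinearMap.llcomp ℂ (DrinfeldDouble G) (DrinfeldDouble G) (DrinfeldDouble G)).flip.comp
        (mulHom G)).flip.comp (mulHom G) := by
    refine hom_ext fun g x => hom_ext fun h y => hom_ext fun k z => ?_
    simp only [LinearMap.compr₂_apply, LinearMap.comp_apply, LinearMap.flip_apply,
      LinearMap.llcomp_apply, mulHom_e, e_mul_e]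
    have key : ∀ t : G, x * y * t * (x * y)⁻¹ = x * (y * t * y⁻¹) * x⁻¹ := fun t => by group
    by_cases h2 : h = y * k * y⁻¹
    · by_cases h1 : g = x * h * x⁻¹
      · rw [if_pos h1, if_pos h2, mulHom_e, mulHom_e, e_mul_e, e_mul_e, if_pos h1, key, ← h2,
          if_pos h1, mul_assoc]
      · rw [if_neg h1, if_pos h2, mulHom_e, e_mul_e, if_neg h1]
        simp
    · rw [if_neg h2, map_zero]
      split_ifs with h1
      · rw [mulHom_e, e_mul_e, key, if_neg]
        rintro rfl
        exact h2 (by simpa using h1.symm)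
      · simp
  exact LinearMap.congr_fun (LinearMap.congr_fun (LinearMap.congr_fun this a) b) c

variable [Fintype G]

/-- The unit `1 = ∑_g e_g 1` of `D(G)`. -/
instance : One (DrinfeldDouble G) := ⟨∑ g : G, e g 1⟩

theorem one_def : (1 : DrinfeldDouble G) = ∑ g : G, e g 1 := rfl

theorem one_mul_aux (a : DrinfeldDouble G) : 1 * a = a := by
  classical
  have : mulHom G 1 = LinearMap.id := by
    refine hom_ext fun h y => ?_
    simp [one_def, mulHom_e, e_mul_e]
  exact LinearMap.congr_fun this a

theorem mul_one_aux (a : DrinfeldDouble G) : a * 1 = a := by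
  classical
  have : (mulHom G).flip 1 = LinearMap.id := by
    refine hom_ext fun g x => ?_
    have hh : ∀ h : G, g = x * h * x⁻¹ ↔ h = x⁻¹ * g * x := fun h => by
      constructor <;> rintro rfl <;> group
    simp [one_def, mulHom_e, e_mul_e, hh]
  exact LinearMap.congr_fun this a

instance : Ring (DrinfeldDouble G) where
  __ := (inferInstance : AddCommGroup (DrinfeldDouble G))
  mul := (· * ·)
  one := 1
  left_distrib a b c := map_add (mulHom G a) b c
  right_distrib a b c := by simp [mul_def]
  zero_mul a := by simp [mul_def]
  mul_zero a := by simp [mul_def]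
  mul_assoc := mul_assoc_aux
  one_mul := one_mul_aux
  mul_one := mul_one_aux

instance : Algebra ℂ (DrinfeldDouble G) :=
  Algebra.ofModule (fun r a b => by simp [mul_def]) (fun r a b => by simp [mul_def])

/-- The comultiplication `Δ(e_g x) = ∑_{a b = g} e_a x ⊗ e_b x` and the counit
`ε(e_g x) = δ_{g, 1}` of `D(G)`. -/
instance : CoalgebraStruct ℂ (DrinfeldDouble G) where
  comul := (basis G).constr ℂ fun p => ∑ a : G, e a p.2 ⊗ₜ[ℂ] e (a⁻¹ * p.1) p.2
  counit := by
    classical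
    exact (basis G).constr ℂ fun p => if p.1 = 1 then 1 else 0

theorem comul_e (g x : G) :
    Coalgebra.comul (R := ℂ) (e g x) = ∑ a : G, e a x ⊗ₜ[ℂ] e (a⁻¹ * g) x := by
  exact (basis G).constr_basis ℂ _ (g, x)

open Classical in
theorem counit_e (g x : G) :
    Coalgebra.counit (R := ℂ) (e g x) = if g = 1 then 1 else 0 := by
  refine ((basis G).constr_basis ℂ _ (g, x)).trans ?_
  congr

instance : Coalgebra ℂ (DrinfeldDouble G) where
  coassoc := by
    refine hom_ext fun g x => ?_
    simp only [LinearMap.comp_apply, comul_e, map_sum, LinearMap.rTensor_tmul,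
      LinearMap.lTensor_tmul, TensorProduct.sum_tmul, TensorProduct.tmul_sum,
      LinearEquiv.coe_coe, TensorProduct.assoc_tmul]
    rw [Finset.sum_comm]
    refine Finset.sum_congr rfl fun a _ => ?_
    refine Fintype.sum_equiv (Equiv.mulLeft a⁻¹) _ _ fun b => ?_
    simp [mul_assoc]
  rTensor_counit_comp_comul := by
    classical
    refine hom_ext fun g x => ?_
    simp [comul_e, counit_e, TensorProduct.ite_tmul]
  lTensor_counit_comp_comul := by
    classical
    refine hom_ext fun g x => ?_
    simp [comul_e, counit_e, TensorProduct.tmul_ite, inv_mul_eq_one]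

theorem counit_mul_aux (a b : DrinfeldDouble G) :
    Coalgebra.counit (R := ℂ) (a * b) = Coalgebra.counit (R := ℂ) a * Coalgebra.counit (R := ℂ) b := by
  classical
  have : (mulHom G).compr₂ (Coalgebra.counit (R := ℂ)) =
      (LinearMap.mul ℂ ℂ).compl₁₂ (Coalgebra.counit (R := ℂ)) (Coalgebra.counit (R := ℂ)) := by
    refine hom_ext fun g x => hom_ext fun h y => ?_
    simp only [LinearMap.compr₂_apply, LinearMap.compl₁₂_apply, LinearMap.mul_apply', mulHom_e,
      e_mul_e, counit_e]
    by_cases hg : g = 1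
    · subst hg
      by_cases hh : h = 1
      · subst hh; simp [counit_e]
      · have : ¬ (1 : G) = x * h * x⁻¹ := fun t => hh (by simpa using t.symm)
        simp [hh, this]
    · split_ifs <;> simp [counit_e, hg]
  exact LinearMap.congr_fun (LinearMap.congr_fun this a) b

theorem comul_mul_aux (a b : DrinfeldDouble G) :
    Coalgebra.comul (R := ℂ) (a * b) = Coalgebra.comul (R := ℂ) a * Coalgebra.comul (R := ℂ) b := by
  classical
  have : (mulHom G).compr₂ (Coalgebra.comul (R := ℂ)) =
      (LinearMap.mul ℂ (DrinfeldDouble G ⊗[ℂ] DrinfeldDouble G)).compl₁₂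
        (Coalgebra.comul (R := ℂ)) (Coalgebra.comul (R := ℂ)) := by
    refine hom_ext fun g x => hom_ext fun h y => ?_
    simp only [LinearMap.compr₂_apply, LinearMap.compl₁₂_apply, LinearMap.mul_apply', mulHom_e,
      comul_e, Finset.sum_mul, Finset.mul_sum, Algebra.TensorProduct.tmul_mul_tmul, e_mul_e]
    have step : ∀ c : G, (∑ d : G, (if c = x * d * x⁻¹ then e c (x * y) else 0) ⊗ₜ[ℂ]
        (if c⁻¹ * g = x * (d⁻¹ * h) * x⁻¹ then e (c⁻¹ * g) (x * y) else 0)) =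
        if g = x * h * x⁻¹ then e c (x * y) ⊗ₜ[ℂ] e (c⁻¹ * g) (x * y) else 0 := fun c => by
      rw [Finset.sum_eq_single (x⁻¹ * c * x)]
      · have h1 : x * (x⁻¹ * c * x) * x⁻¹ = c := by group
        have h2 : x * ((x⁻¹ * c * x)⁻¹ * h) * x⁻¹ = c⁻¹ * (x * h * x⁻¹) := by group
        rw [h1, h2, if_pos rfl]
        simp only [mul_right_inj]
        split_ifs <;> simp
      · intro d _ hd
        rw [if_neg, TensorProduct.zero_tmul]
        rintro rfl
        exact hd (by group)
      · simp
    rw [Finset.sum_comm]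
    simp only [step]
    split_ifs
    · rw [comul_e]
    · simp
  exact LinearMap.congr_fun (LinearMap.congr_fun this a) b

instance : Bialgebra ℂ (DrinfeldDouble G) :=
  Bialgebra.mk' ℂ (DrinfeldDouble G)
    (by classical simp [one_def, counit_e])
    (fun {a b} => counit_mul_aux a b)
    (by
      rw [Algebra.TensorProduct.one_def, one_def]
      simp only [map_sum, comul_e, TensorProduct.sum_tmul, TensorProduct.tmul_sum]
      rw [Finset.sum_comm]
      nth_rewrite 2 [Finset.sum_comm]
      refine Finset.sum_congr rfl fun a _ => ?_
      exact Fintype.sum_equiv (Equiv.mulLeft a⁻¹) _ _ fun b => by simp)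
    (fun {a b} => comul_mul_aux a b)

/-- The antipode `S(e_g x) = e_{x⁻¹ g⁻¹ x} x⁻¹` of `D(G)`. -/
instance : HopfAlgebraStruct ℂ (DrinfeldDouble G) where
  antipode := (basis G).constr ℂ fun p => e (p.2⁻¹ * p.1⁻¹ * p.2) p.2⁻¹

theorem antipode_e (g x : G) :
    HopfAlgebra.antipode ℂ (e g x) = e (x⁻¹ * g⁻¹ * x) x⁻¹ :=
  (basis G).constr_basis ℂ _ (g, x)

instance : HopfAlgebra ℂ (DrinfeldDouble G) where
  mul_antipode_rTensor_comul := by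
    classical
    refine hom_ext fun g x => ?_
    have hh : ∀ a : G, x⁻¹ * a⁻¹ * x = x⁻¹ * (a⁻¹ * g) * x⁻¹⁻¹ ↔ g = 1 := fun a => by
      simp [mul_assoc]
    simp only [LinearMap.comp_apply, comul_e, map_sum, LinearMap.rTensor_tmul,
      LinearMap.mul'_apply, antipode_e, e_mul_e, hh, counit_e]
    split_ifs
    · simp only [inv_mul_cancel, Algebra.linearMap_apply, map_one, one_def]
      exact Fintype.sum_equiv ((Equiv.inv G).trans (MulAut.conj x⁻¹).toEquiv) _ _
        fun b => by simp
    · simp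
  mul_antipode_lTensor_comul := by
    classical
    refine hom_ext fun g x => ?_
    have hh : ∀ a : G, a = x * (x⁻¹ * (a⁻¹ * g)⁻¹ * x) * x⁻¹ ↔ g = 1 := fun a => by
      simp [mul_assoc]
    simp only [LinearMap.comp_apply, comul_e, map_sum, LinearMap.lTensor_tmul,
      LinearMap.mul'_apply, antipode_e, e_mul_e, hh, counit_e]
    split_ifs
    · simp [one_def]
    · simp

/-- The normalized integral `Λ = |G|⁻¹ ∑_x e_1 x` of `D(G)`. -/
def integral (G : Type*) [Group G] [Fintype G] : DrinfeldDouble G :=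
  (Fintype.card G : ℂ)⁻¹ • ∑ x : G, e 1 x

/-- `Λ` is a two-sided integral of `D(G)` and is normalized by `ε(Λ) = 1`; these properties
determine `Λ`. -/
theorem integral_spec :
    (∀ a : DrinfeldDouble G, a * integral G = Coalgebra.counit (R := ℂ) a • integral G) ∧
    (∀ a : DrinfeldDouble G, integral G * a = Coalgebra.counit (R := ℂ) a • integral G) ∧
    Coalgebra.counit (R := ℂ) (integral G) = 1 := by
  classical
  refine ⟨fun a => ?_, fun a => ?_, ?_⟩
  · have : (mulHom G).flip (integral G) =
        (Coalgebra.counit (R := ℂ) (A := DrinfeldDouble G)).smulRight (integral G) := by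
      refine hom_ext fun g x => ?_
      rw [LinearMap.flip_apply]
      simp only [integral, map_smul, map_sum, mulHom_e, e_mul_e,
        LinearMap.smulRight_apply, counit_e, mul_one, mul_inv_cancel]
      split_ifs with h
      · subst h
        rw [one_smul]
        congr 1
        exact Fintype.sum_equiv (Equiv.mulLeft x) _ _ fun b => rfl
      · simp
    exact LinearMap.congr_fun this a
  · have : mulHom G (integral G) =
        (Coalgebra.counit (R := ℂ) (A := DrinfeldDouble G)).smulRight (integral G) := by
      refine hom_ext fun g x => ?_
      have hh : ∀ y : G, 1 = y * g * y⁻¹ ↔ g = 1 := fun y => by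
        rw [eq_comm, conj_eq_one_iff]
      simp only [integral, map_smul, map_sum, LinearMap.smul_apply, LinearMap.sum_apply, mulHom_e,
        e_mul_e, LinearMap.smulRight_apply, counit_e, hh]
      split_ifs with h
      · rw [one_smul]
        congr 1
        exact Fintype.sum_equiv (Equiv.mulRight x) _ _ fun b => rfl
      · simp
    exact LinearMap.congr_fun this a
  · simp [integral, counit_e]

end DrinfeldDouble

/-- The Sweedler power map `h ↦ h^{[n]} = h₁ h₂ ⋯ hₙ` of a complex Hopf algebra, with
`h^{[0]} = ε(h) 1`. -/
def sweedlerPow (H : Type*) [Ring H] [HopfAlgebra ℂ H] : ℕ → H →ₗ[ℂ] H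
  | 0 => Algebra.linearMap ℂ H ∘ₗ Coalgebra.counit
  | n + 1 => LinearMap.mul' ℂ H ∘ₗ (sweedlerPow H n).lTensor H ∘ₗ Coalgebra.comul

/-- The `n`-th Frobenius-Schur indicator `ν_n(V) = χ_V(Λ^{[n]})` of a representation `V` of the
Drinfel'd double `D(G)`. -/
def fsIndicator (G : Type*) [Group G] [Fintype G] (n : ℕ) (V : Type*) [AddCommGroup V]
    [Module ℂ V] [Module (DrinfeldDouble G) V] [IsScalarTower ℂ (DrinfeldDouble G) V] : ℂ :=
  LinearMap.trace ℂ V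
    (Algebra.lsmul ℂ ℂ V (sweedlerPow (DrinfeldDouble G) n (DrinfeldDouble.integral G)))

/-- `G` is an `FSZ_n`-group: the `n`-th indicator of every irreducible representation of `D(G)` is
an integer. (Every such representation is finite dimensional, so it is isomorphic to one whose
underlying space lies in `Type`.) -/
def IsFSZn (n : ℕ) (G : Type*) [Group G] [Fintype G] : Prop :=
  ∀ (V : Type) [AddCommGroup V] [Module ℂ V] [FiniteDimensional ℂ V]
    [Module (DrinfeldDouble G) V] [IsScalarTower ℂ (DrinfeldDouble G) V]
    [IsSimpleModule (DrinfeldDouble G) V], ∃ k : ℤ, fsIndicator G n V = k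

/-- `G` is an `FSZ`-group: it is an `FSZ_n`-group for every positive integer `n`. -/
def IsFSZ (G : Type*) [Group G] [Fintype G] : Prop :=
  ∀ n : ℕ, 0 < n → IsFSZn n G

/-- The set `G_n(u, g) = {a ∈ G | (a u⁻¹)^n = a^n = g}`. -/
def gSet {G : Type*} [Group G] (n : ℕ) (u g : G) : Set G :=
  {a | (a * u⁻¹) ^ n = a ^ n ∧ a ^ n = g}

/-- The subgroup `C_G(u, g)` of the elements that commute with both `u` and `g`. -/
abbrev pairCentralizer {G : Type*} [Group G] (u g : G) : Subgroup G :=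
  Subgroup.centralizer {u, g}

/-- The action by conjugation of a subgroup `K` of `G` on a set `S` of elements of `G` that is
stable under conjugation by `K`. -/
@[reducible] def conjActionOn {G : Type*} [Group G] (K : Subgroup G) (S : Set G)
    (hS : ∀ h ∈ K, ∀ a ∈ S, h * a * h⁻¹ ∈ S) : MulAction K S where
  smul h a := ⟨h * a * (h : G)⁻¹, hS h h.2 a a.2⟩
  one_smul a := Subtype.ext (show (1 : G) * a * (1 : G)⁻¹ = a by simp)
  mul_smul h k a := Subtype.ext
    (show (h * k : G) * a * (h * k : G)⁻¹ = h * (k * a * (k : G)⁻¹) * (h : G)⁻¹ by group)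

/-- The complex permutation module `ℂ[S]` afforded by the conjugation action of `K` on `S`. -/
def permRep {G : Type*} [Group G] (K : Subgroup G) (S : Set G)
    (hS : ∀ h ∈ K, ∀ a ∈ S, h * a * h⁻¹ ∈ S) : Representation ℂ K (MonoidAlgebra ℂ S) :=
  letI := conjActionOn K S hS
  Representation.ofMulAction ℂ K S

theorem gSet_zpow_conj {G : Type*} [Group G] (n : ℕ) (u g : G) (m : ℤ) :
    ∀ h ∈ pairCentralizer u g, ∀ a ∈ gSet n u (g ^ m), h * a * h⁻¹ ∈ gSet n u (g ^ m) := by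
  rintro h hh a ⟨h1, h2⟩
  have hu : Commute u h := Subgroup.mem_centralizer_iff.1 hh u (by simp)
  have hg : Commute g h := Subgroup.mem_centralizer_iff.1 hh g (by simp)
  have h3 : h * a * h⁻¹ * u⁻¹ = h * (a * u⁻¹) * h⁻¹ := by
    have : h⁻¹ * u⁻¹ = u⁻¹ * h⁻¹ := (hu.inv_inv).symm.eq
    simp only [mul_assoc, this]
  refine ⟨?_, ?_⟩
  · rw [h3, conj_pow, conj_pow, h1]
  · rw [conj_pow, h2, ← (hg.zpow_left m).eq, mul_inv_cancel_right]

theorem gSet_conj {G : Type*} [Group G] (n : ℕ) (u g : G) :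
    ∀ h ∈ pairCentralizer u g, ∀ a ∈ gSet n u g, h * a * h⁻¹ ∈ gSet n u g := by
  simpa using gSet_zpow_conj n u g 1

/-- `G` is an `FSZ⁺_n`-group: for all commuting `u, g ∈ G` and all integers `m` coprime to `|G|`,
the sets `G_n(u, g)` and `G_n(u, g^m)` afford isomorphic permutation modules for `C_G(u, g)`. -/
def IsFSZPlusN (n : ℕ) (G : Type*) [Group G] : Prop :=
  ∀ u g : G, Commute u g → ∀ m : ℤ, IsCoprime m (Nat.card G : ℤ) →
    Nonempty ((permRep (pairCentralizer u g) (gSet n u g) (gSet_conj n u g)).Equiv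
      (permRep (pairCentralizer u g) (gSet n u (g ^ m)) (gSet_zpow_conj n u g m)))

/-- `G` is an `FSZ⁺`-group: it is an `FSZ⁺_n`-group for every positive integer `n`. -/
def IsFSZPlus (G : Type*) [Group G] : Prop :=
  ∀ n : ℕ, 0 < n → IsFSZPlusN n G

/-- `G` is a (finite) dihedral group: it is isomorphic to the dihedral group of order `2n` for
some `n ≥ 1`. -/
def IsDihedral (G : Type*) [Group G] : Prop :=
  ∃ n : ℕ, 0 < n ∧ Nonempty (G ≃* DihedralGroup n)

end

noncomputable section

/-! ### Sweedler powers of the integral, and characters of `D(G)`. -/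

namespace DrinfeldDouble

variable {G : Type*} [Group G] [Fintype G]

/-! All integrality comes from idempotents: an idempotent of `D(G)` acts as a projection, whose
trace is its rank (`character_of_isIdempotentElem`). By `sweedlerPow_integral`, ν_n(V) is |G|⁻¹
times the sum of χ(e_b xⁿ) over the pairs (x, b) with (b x⁻¹)ⁿ xⁿ = 1. If G is abelian, Λ^[n] is
itself idempotent.

For the dihedral group of order 2k one must gain a factor 2k. Pairs of rotations are
Fourier-expanded into idempotents indexed by (i, j) in (ZMod k)², which yields the factor k
(`sum_rotation_terms`). Conjugation by a reflection exchanges the indices (i, j) and (-i, -j), and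
pairing them yields the factor 2. The terms involving reflections are the same for every odd n, so
they cancel against ν_1; for even n they are handled by `dvd_card_mul_sum` and by the rotation sum
with n = 0.

In SL_2(F) the centralizer of a noncentral X is abelian, because commuting matrices have
proportional trace-free parts. In PSL_2(F) the only further elements centralizing the image of X
come from A with AX = -XA. Outside characteristic two this forces tr X = 0, so X² = -1 and the image
is an involution. Then the SL_2-centralizer of X is cyclic, and an anticommuting element, if there
is one, maps to an involution inverting it: the centralizer is dihedral.

Hence in PSL_2(F) every g has g² = 1 or an abelian centralizer, which suffices for FSZ⁺
(`isFSZPlus_of_centralizer`). If g² = 1, then g^m = g. If the centralizer is abelian, every a in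
G_n(u, g) commutes with u, and a ↦ a^m is an equivariant bijection onto G_n(u, g^m). -/

-- A product of basis vectors e_{a₁}x ⋯ e_{aₙ}x is nonzero only if each a_{i+1} is x⁻¹ a_i x. So a₁
-- = b determines all factors, and a₁⋯aₙ telescopes to (b x⁻¹)ⁿ xⁿ.
open Classical in
theorem sweedlerPow_e (n : ℕ) (g x : G) :
    sweedlerPow (DrinfeldDouble G) n (e g x) =
      ∑ b : G, if (b * x⁻¹) ^ n * x ^ n = g then e b (x ^ n) else 0 := by
  induction n generalizing g with
  | zero =>
    simp only [sweedlerPow, LinearMap.comp_apply, counit_e, Algebra.linearMap_apply, pow_zero,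
      mul_one, eq_comm (a := (1 : G))]
    split_ifs <;> simp [one_def]
  | succ n ih =>
    simp only [sweedlerPow, LinearMap.comp_apply, comul_e, map_sum, LinearMap.lTensor_tmul,
      LinearMap.mul'_apply, ih, Finset.mul_sum, mul_ite, mul_zero, e_mul_e]
    refine Finset.sum_congr rfl fun a _ => ?_
    rw [Finset.sum_eq_single (x⁻¹ * a * x)]
    · have h1 : a = x * (x⁻¹ * a * x) * x⁻¹ := by group
      have h2 : (a * x⁻¹) ^ (n + 1) * x ^ (n + 1) = a * ((x⁻¹ * a) ^ n * x ^ n) := by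
        have : (x⁻¹ * a) ^ n = x⁻¹ * (a * x⁻¹) ^ n * x := by
          have := conj_pow (i := n) (a := x⁻¹) (b := a * x⁻¹)
          rw [inv_inv] at this
          rw [← this]
          congr 1
          group
        rw [this, pow_succ' (a * x⁻¹), pow_succ' x]
        group
      rw [if_pos h1, mul_inv_cancel_right, h2, ← pow_succ' x]
      simp only [eq_inv_mul_iff_mul_eq]
    · intro b _ hb
      have : ¬ a = x * b * x⁻¹ := by
        rintro rfl
        exact hb (by group)
      rw [if_neg this, ite_self]
    · simp

open Classical in
theorem sweedlerPow_integral (n : ℕ) :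
    sweedlerPow (DrinfeldDouble G) n (integral G) =
      (Fintype.card G : ℂ)⁻¹ • ∑ x : G, ∑ b : G,
        if (b * x⁻¹) ^ n * x ^ n = 1 then e b (x ^ n) else 0 := by
  simp only [integral, map_smul, map_sum, sweedlerPow_e]

omit [Fintype G] in
theorem e_mul_e_self (g x y : G) (h : Commute x g) : e g x * e g y = e g (x * y) := by
  rw [e_mul_e, if_pos (by rw [h.eq, mul_inv_cancel_right])]

theorem e_mul_e_of_ne {g h x : G} (y : G) (hg : Commute x g) (hgh : g ≠ h) :
    e g x * e h y = 0 := by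
  rw [e_mul_e, if_neg]
  rintro rfl
  refine hgh ?_
  have : x * (x * h * x⁻¹) = x * h := by rw [hg.eq]; group
  exact mul_left_cancel this

variable (G) in
/-- The character of a finite-dimensional representation of `D(G)`. -/
def character (V : Type*) [AddCommGroup V]
    [Module ℂ V] [Module (DrinfeldDouble G) V] [IsScalarTower ℂ (DrinfeldDouble G) V] :
    DrinfeldDouble G →ₗ[ℂ] ℂ :=
  LinearMap.trace ℂ V ∘ₗ (Algebra.lsmul ℂ ℂ V : DrinfeldDouble G →ₐ[ℂ] _).toLinearMap

section character

variable (V : Type*) [AddCommGroup V] [Module ℂ V]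
  [Module (DrinfeldDouble G) V] [IsScalarTower ℂ (DrinfeldDouble G) V]

theorem fsIndicator_eq_character (n : ℕ) :
    fsIndicator G n V = character G V (sweedlerPow (DrinfeldDouble G) n (integral G)) := rfl

theorem character_mul_comm (a b : DrinfeldDouble G) :
    character G V (a * b) = character G V (b * a) := by
  simp only [character, LinearMap.comp_apply, AlgHom.toLinearMap_apply, map_mul]
  exact LinearMap.trace_mul_comm ℂ _ _

theorem character_of_isIdempotentElem [FiniteDimensional ℂ V] {p : DrinfeldDouble G}
    (hp : IsIdempotentElem p) : ∃ k : ℕ, character G V p = k := by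
  refine ⟨_, LinearMap.IsProj.trace
    (LinearMap.IsIdempotentElem.isProj_range _ (hp.map (Algebra.lsmul ℂ ℂ V)))⟩

/-- Both basis vectors are products of e_g (x h⁻¹) and e_{hgh⁻¹} h, taken in opposite orders, so the
trace property applies. -/
theorem character_conj (g x h : G) (hg : Commute x g) :
    character G V (e (h * g * h⁻¹) (h * x * h⁻¹)) = character G V (e g x) := by
  have h1 : e (h * g * h⁻¹) (h * x * h⁻¹) = e (h * g * h⁻¹) h * e g (x * h⁻¹) := by
    rw [e_mul_e, if_pos rfl, mul_assoc h x]
  have h2 : e g x = e g (x * h⁻¹) * e (h * g * h⁻¹) h := by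
    rw [e_mul_e, if_pos, inv_mul_cancel_right]
    have : x * h⁻¹ * (h * g * h⁻¹) * (x * h⁻¹)⁻¹ = x * g * x⁻¹ := by group
    rw [this, hg.eq, mul_inv_cancel_right]
  rw [h1, character_mul_comm, ← h2]

end character

end DrinfeldDouble

/-! ### Abelian groups. -/

open DrinfeldDouble in
theorem isFSZ_of_commGroup (A : Type*) [CommGroup A] [Fintype A] : IsFSZ A := by
  classical
  intro n _ V _ _ _ _ _ _
  rw [fsIndicator_eq_character]
  -- In the abelian case the condition on (x, b) reduces to bⁿ = 1. For each such b, the average of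
  -- xⁿ over x is idempotent because x ↦ xⁿ is a homomorphism, and distinct b give orthogonal terms.
  suffices h : IsIdempotentElem (sweedlerPow (DrinfeldDouble A) n (integral A)) by
    obtain ⟨k, hk⟩ := character_of_isIdempotentElem V h
    exact ⟨k, by simpa using hk⟩
  have hA : (Fintype.card A : ℂ) ≠ 0 := by simp
  have key : sweedlerPow (DrinfeldDouble A) n (integral A) =
      (Fintype.card A : ℂ)⁻¹ • ∑ x : A, ∑ b : A with b ^ n = 1, e b (x ^ n) := by
    rw [sweedlerPow_integral]
    simp [← mul_pow, Finset.sum_filter]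
  have step : ∀ x y : A, (∑ b : A with b ^ n = 1, e b (x ^ n)) *
      (∑ b : A with b ^ n = 1, e b (y ^ n)) = ∑ b : A with b ^ n = 1, e b ((x * y) ^ n) := by
    intro x y
    rw [Finset.sum_mul_sum]
    refine Finset.sum_congr rfl fun b hb => ?_
    rw [Finset.sum_eq_single_of_mem b hb fun c _ hc => e_mul_e_of_ne _ (Commute.all _ _) hc.symm,
      e_mul_e_self _ _ _ (Commute.all _ _), mul_pow]
  have step2 : ∀ x : A, ∑ y : A, ∑ b : A with b ^ n = 1, e b ((x * y) ^ n) =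
      ∑ y : A, ∑ b : A with b ^ n = 1, e b (y ^ n) :=
    fun x => Fintype.sum_equiv (Equiv.mulLeft x)
      (fun y => ∑ b : A with b ^ n = 1, e b ((x * y) ^ n)) _ fun y => rfl
  rw [IsIdempotentElem, key, smul_mul_smul_comm, Finset.sum_mul_sum]
  simp only [step, step2]
  rw [Finset.sum_const, Finset.card_univ, ← Nat.cast_smul_eq_nsmul ℂ, smul_smul, mul_assoc,
    inv_mul_cancel₀ hA, mul_one]

/-! ### Parity, dihedral arithmetic and a divisibility. -/

theorem even_sum_of_involution {ι : Type*} (s : Finset ι) (f : ι → ℕ) (σ : ι → ι)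
    (hσ : ∀ i ∈ s, σ i ∈ s) (hne : ∀ i ∈ s, σ i ≠ i) (hinv : ∀ i ∈ s, σ (σ i) = i)
    (hf : ∀ i ∈ s, f (σ i) = f i) : Even (∑ i ∈ s, f i) := by
  rw [← ZMod.natCast_eq_zero_iff_even, Nat.cast_sum]
  refine Finset.sum_involution (fun i _ => σ i) (fun i hi => ?_) (fun i hi _ => hne i hi) hσ hinv
  rw [hf i hi, ← two_mul]
  exact mul_eq_zero_of_left (by decide) _

theorem DihedralGroup.sum_eq {k : ℕ} [NeZero k] {M : Type*} [AddCommMonoid M]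
    (f : DihedralGroup k → M) :
    ∑ x, f x = ∑ i, f (DihedralGroup.r i) + ∑ i, f (DihedralGroup.sr i) := by
  rw [← Fintype.sum_equiv DihedralGroup.equivSum.symm (f ∘ DihedralGroup.equivSum.symm) f
    (fun _ => rfl), Fintype.sum_sum_type]
  rfl

theorem DihedralGroup.sr_pow {k : ℕ} (i : ZMod k) (n : ℕ) :
    (DihedralGroup.sr i) ^ n = if Even n then 1 else DihedralGroup.sr i := by
  have h : (DihedralGroup.sr i) ^ 2 = 1 := by rw [sq, DihedralGroup.sr_mul_self]
  split_ifs with hn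
  · obtain ⟨m, rfl⟩ := hn
    rw [← two_mul, pow_mul, h, one_pow]
  · obtain ⟨m, rfl⟩ := Nat.not_even_iff_odd.1 hn
    rw [pow_succ, pow_mul, h, one_pow, one_mul]

open DihedralGroup in
theorem DihedralGroup.r_eq_one_iff {k : ℕ} (i : ZMod k) :
    (r i : DihedralGroup k) = 1 ↔ i = 0 := by
  rw [one_def, r.injEq]

/-- If `w` is a natural-valued function of period `2` on `ZMod k`, then `k` divides
`|{l | n l = 0}| ∑ i, w i` for even `n`. -/
theorem dvd_card_mul_sum {k : ℕ} [NeZero k] (n : ℕ) (hn : Even n) (w : ZMod k → ℕ)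
    (hw : ∀ i, w (i + 2) = w i) :
    k ∣ (Finset.univ.filter fun l : ZMod k => l * n = 0).card * ∑ i, w i := by
  have hc : ∀ i, w i + w (i + 1) = w 0 + w 1 := by
    intro i
    obtain ⟨j, rfl⟩ := ZMod.natCast_zmod_surjective i
    induction j with
    | zero => simp
    | succ j ih =>
      rw [← ih]
      have := hw j
      push_cast
      rw [add_assoc, one_add_one_eq_two, this, add_comm]
  -- Consecutive values have constant sum, so adding the sum of `w` to its shift gives the factor k
  -- up to 2. For odd k the 2 is harmless; for even k it is absorbed by the torsion count.
  have hW : 2 * ∑ i, w i = k * (w 0 + w 1) := by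
    have h1 : ∑ i, w (i + 1) = ∑ i, w i :=
      Fintype.sum_equiv (Equiv.addRight 1) _ _ fun _ => rfl
    have h2 : ∑ i, (w i + w (i + 1)) = k * (w 0 + w 1) := by simp [hc]
    rw [← h2, Finset.sum_add_distrib, h1, two_mul]
  rcases Nat.even_or_odd k with hk | hk
  -- Translation by k/2 is a fixed-point-free involution of the n-torsion, since n is even.
  · have hd : Even (∑ l ∈ Finset.univ.filter fun l : ZMod k => l * n = 0, 1) := by
      obtain ⟨h, rfl⟩ := hk
      have h0 : 0 < h := by have := NeZero.pos (h + h); omega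
      have h2 : ((h : ℕ) : ZMod (h + h)) + (h : ℕ) = 0 := by
        rw [← Nat.cast_add, ZMod.natCast_self]
      refine even_sum_of_involution _ _ (fun l => l + (h : ℕ)) ?_ ?_ ?_ ?_
      · intro l hl
        obtain ⟨m, rfl⟩ := hn
        simp only [Finset.mem_filter, Finset.mem_univ, true_and] at hl ⊢
        rw [add_mul, hl, zero_add]
        push_cast
        linear_combination (m : ZMod (h + h)) * h2
      · intro l _ hl
        rw [add_eq_left, ZMod.natCast_eq_zero_iff] at hl
        exact absurd (Nat.le_of_dvd h0 hl) (by omega)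
      · intro l _
        rw [add_assoc, h2, add_zero]
      · simp
    rw [← Finset.card_eq_sum_ones] at hd
    obtain ⟨d, hd⟩ := hd
    rw [hd, ← two_mul, mul_comm 2 d, mul_assoc, hW]
    exact Dvd.dvd.mul_left (Dvd.intro _ rfl) _
  · refine Dvd.dvd.mul_left ?_ _
    exact (Nat.Coprime.dvd_of_dvd_mul_left (Nat.coprime_two_right.2 hk) (Dvd.intro _ hW.symm))

/-! ### Fourier analysis on the rotation subgroup. -/

namespace DrinfeldDouble

open DihedralGroup

variable {G : Type*} [Group G] [Fintype G] {k : ℕ} [NeZero k] (φ : DihedralGroup k ≃* G)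

/-- The idempotent of `D(G)` attached to a rotation and a linear character of the rotation
subgroup of a dihedral group `G`. -/
def rotationIdempotent (i j : ZMod k) : DrinfeldDouble G :=
  (k : ℂ)⁻¹ • ∑ l : ZMod k, ZMod.stdAddChar (l * j) • e (φ (r i)) (φ (r l))

theorem rotationIdempotent_isIdempotentElem (i j : ZMod k) :
    IsIdempotentElem (rotationIdempotent φ i j) := by
  have hk : (k : ℂ) ≠ 0 := NeZero.ne _
  have step : ∀ l m : ZMod k, (ZMod.stdAddChar (l * j) • e (φ (r i)) (φ (r l))) *
      ((ZMod.stdAddChar (m * j) : ℂ) • e (φ (r i)) (φ (r m))) =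
      (ZMod.stdAddChar ((l + m) * j) : ℂ) • e (φ (r i)) (φ (r (l + m))) := by
    intro l m
    have hc : Commute (φ (r l)) (φ (r i)) := by
      rw [Commute, SemiconjBy, ← map_mul, ← map_mul, r_mul_r, r_mul_r, add_comm]
    rw [smul_mul_smul_comm, e_mul_e_self _ _ _ hc, ← map_mul φ, r_mul_r, add_mul,
      AddChar.map_add_eq_mul]
  have step2 : ∀ l : ZMod k, ∑ m : ZMod k,
      (ZMod.stdAddChar ((l + m) * j) : ℂ) • e (φ (r i)) (φ (r (l + m))) =
      ∑ m : ZMod k, (ZMod.stdAddChar (m * j) : ℂ) • e (φ (r i)) (φ (r m)) :=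
    fun l => Fintype.sum_equiv (Equiv.addLeft l) _ _ fun y => rfl
  rw [IsIdempotentElem, rotationIdempotent, smul_mul_smul_comm, Finset.sum_mul_sum]
  simp only [step, step2]
  rw [Finset.sum_const, Finset.card_univ, ZMod.card, ← Nat.cast_smul_eq_nsmul ℂ, smul_smul,
    mul_assoc, inv_mul_cancel₀ hk, mul_one]

/-- Fourier inversion on `ZMod k`: it turns characters of basis vectors into combinations of ranks.
-/
theorem sum_rotationIdempotent (i l : ZMod k) :
    ∑ j, (ZMod.stdAddChar (-(j * l)) : ℂ) • rotationIdempotent φ i j =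
      e (φ (r i)) (φ (r l)) := by
  have hk : (k : ℂ) ≠ 0 := NeZero.ne _
  simp only [rotationIdempotent, Finset.smul_sum, smul_smul]
  rw [Finset.sum_comm]
  have h : ∀ m : ZMod k, ∑ j : ZMod k, (ZMod.stdAddChar (-(j * l)) * ((k : ℂ)⁻¹ *
      ZMod.stdAddChar (m * j))) = if m = l then 1 else 0 := by
    intro m
    have h1 : ∀ j : ZMod k, (ZMod.stdAddChar (-(j * l)) * ((k : ℂ)⁻¹ *
      ZMod.stdAddChar (m * j)) : ℂ) = (k : ℂ)⁻¹ * ZMod.stdAddChar (j * (m - l)) := by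
      intro j
      rw [mul_left_comm, ← AddChar.map_add_eq_mul]
      ring_nf
    simp only [h1]
    rw [← Finset.mul_sum, AddChar.sum_mulShift _ (ZMod.isPrimitive_stdAddChar k), ZMod.card]
    simp only [sub_eq_zero]
    split_ifs <;> simp [hk]
  simp only [← Finset.sum_smul, h]
  simp

/-- After Fourier inversion, summing over l kills every j with jn ≠ 0 by orthogonality and
multiplies the others by k. -/
theorem sum_character_rotation (V : Type*) [AddCommGroup V] [Module ℂ V]
    [Module (DrinfeldDouble G) V] [IsScalarTower ℂ (DrinfeldDouble G) V] (i : ZMod k) (n : ℕ) :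
    ∑ l : ZMod k, character G V (e (φ (r i)) (φ (r (l * (n : ZMod k))))) =
      k * ∑ j : ZMod k with j * (n : ZMod k) = 0, character G V (rotationIdempotent φ i j) := by
  have h : ∀ j : ZMod k, (∑ l : ZMod k, (ZMod.stdAddChar (-(j * (l * (n : ZMod k)))) : ℂ)) =
      if j * (n : ZMod k) = 0 then (k : ℂ) else 0 := by
    intro j
    have := AddChar.sum_mulShift (-(j * (n : ZMod k))) (ZMod.isPrimitive_stdAddChar k)
    rw [ZMod.card, Nat.cast_ite, Nat.cast_zero] at this
    simp only [neg_eq_zero] at this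
    rw [← this]
    exact Finset.sum_congr rfl fun l _ => by ring_nf
  simp only [← sum_rotationIdempotent φ, map_sum, map_smul, smul_eq_mul]
  rw [Finset.sum_comm]
  simp only [← Finset.sum_mul, h]
  rw [Finset.mul_sum, Finset.sum_filter]
  simp

/-- Conjugation by the reflection `sr 0` inverts every rotation and preserves characters. -/
theorem character_rotationIdempotent_neg (V : Type*) [AddCommGroup V] [Module ℂ V]
    [Module (DrinfeldDouble G) V] [IsScalarTower ℂ (DrinfeldDouble G) V] (i j : ZMod k) :
    character G V (rotationIdempotent φ (-i) (-j)) =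
      character G V (rotationIdempotent φ i j) := by
  have hs : ∀ l : ZMod k, φ (r (-l)) = φ (sr 0) * φ (r l) * (φ (sr 0))⁻¹ := by
    intro l
    rw [← map_inv, ← map_mul, ← map_mul, inv_sr, sr_mul_r, sr_mul_sr]
    simp
  simp only [rotationIdempotent, map_smul, map_sum]
  congr 1
  refine Fintype.sum_equiv (Equiv.neg _) _ _ fun l => ?_
  have hc : Commute (φ (r (-l))) (φ (r i)) := by
    rw [Commute, SemiconjBy, ← map_mul, ← map_mul, r_mul_r, r_mul_r, add_comm]
  rw [Equiv.neg_apply, ← character_conj V _ _ (φ (sr 0)) hc, ← hs, ← hs, neg_neg, mul_neg, neg_mul]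

omit [NeZero k] in
theorem character_reflection_add_two (V : Type*) [AddCommGroup V] [Module ℂ V]
    [Module (DrinfeldDouble G) V] [IsScalarTower ℂ (DrinfeldDouble G) V] (i : ZMod k) :
    character G V (e (φ (sr (i + 2))) 1) = character G V (e (φ (sr i)) 1) := by
  rw [← character_conj V (φ (sr i)) 1 (φ (r (-1))) (Commute.one_left _), ← map_inv, ← map_mul,
    ← map_mul, inv_r, r_mul_sr, sr_mul_r]
  rw [mul_one, ← map_mul, r_mul_r]
  simp [add_assoc, one_add_one_eq_two]

end DrinfeldDouble

/-! ### Indicators for dihedral groups. -/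

namespace DrinfeldDouble

open DihedralGroup

variable {G : Type*} [Group G] [Fintype G] {k : ℕ} [NeZero k] (φ : DihedralGroup k ≃* G)

open Classical in
theorem two_mul_card_mul_fsIndicator (V : Type*) [AddCommGroup V] [Module ℂ V]
    [Module (DrinfeldDouble G) V] [IsScalarTower ℂ (DrinfeldDouble G) V] (n : ℕ) :
    2 * k * fsIndicator G n V = ∑ x : DihedralGroup k, ∑ b : DihedralGroup k,
      if (b * x⁻¹) ^ n * x ^ n = 1 then character G V (e (φ b) (φ (x ^ n))) else 0 := by
  have hk : (k : ℂ) ≠ 0 := NeZero.ne _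
  have hG : (Fintype.card G : ℂ) = 2 * k := by
    rw [← Fintype.card_congr φ.toEquiv, DihedralGroup.card]
    push_cast
    rfl
  rw [fsIndicator_eq_character, sweedlerPow_integral, map_smul, hG, smul_eq_mul,
    mul_inv_cancel_left₀ (by simp [hk]), map_sum]
  refine (Fintype.sum_equiv φ.toEquiv _ _ fun x => ?_).symm
  rw [map_sum]
  refine Fintype.sum_equiv φ.toEquiv _ _ fun b => ?_
  have h : (φ b * (φ x)⁻¹) ^ n * φ x ^ n = 1 ↔ (b * x⁻¹) ^ n * x ^ n = 1 := by
    rw [← map_inv, ← map_mul, ← map_pow, ← map_pow, ← map_mul, map_eq_one_iff _ φ.injective]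
  simp only [MulEquiv.toEquiv_eq_coe, EquivLike.coe_coe, h, map_pow]
  split_ifs <;> simp

/-- The pairs of residues modulo `k` killed by `n`. -/
def torsionPairs (k n : ℕ) [NeZero k] : Finset (ZMod k × ZMod k) :=
  (Finset.univ.filter fun i : ZMod k => i * n = 0) ×ˢ
    (Finset.univ.filter fun j : ZMod k => j * n = 0)

theorem mem_torsionPairs {n : ℕ} (p : ZMod k × ZMod k) :
    p ∈ torsionPairs k n ↔ p.1 * n = 0 ∧ p.2 * n = 0 := by
  simp [torsionPairs]

theorem neg_mem_torsionPairs {n : ℕ} (p : ZMod k × ZMod k) :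
    -p ∈ torsionPairs k n ↔ p ∈ torsionPairs k n := by
  simp [mem_torsionPairs]

omit [NeZero k] in
theorem mem_torsionPairs_two_of_neg_eq {p : ZMod k × ZMod k} (h : -p = p) :
    p.1 * 2 = 0 ∧ p.2 * 2 = 0 := by
  have h1 : -p.1 = p.1 := congrArg Prod.fst h
  have h2 : -p.2 = p.2 := congrArg Prod.snd h
  constructor
  · linear_combination -h1
  · linear_combination -h2

theorem sum_rotation_terms (V : Type*) [AddCommGroup V] [Module ℂ V]
    [Module (DrinfeldDouble G) V] [IsScalarTower ℂ (DrinfeldDouble G) V] (n : ℕ) :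
    (∑ l : ZMod k, ∑ i : ZMod k, if i * n = 0 then
        character G V (e (φ (r i)) (φ (r (l * n)))) else 0) =
      k * ∑ p ∈ torsionPairs k n, character G V (rotationIdempotent φ p.1 p.2) := by
  rw [Finset.sum_comm, torsionPairs, Finset.sum_product, Finset.mul_sum, Finset.sum_filter]
  refine Finset.sum_congr rfl fun i _ => ?_
  split_ifs
  · exact sum_character_rotation φ V i n
  · simp

section words

variable (i l : ZMod k) (n : ℕ)

omit [NeZero k]

theorem r_r_word_eq_one_iff :
    ((r i : DihedralGroup k) * (r l)⁻¹) ^ n * (r l) ^ n = 1 ↔ i * (n : ZMod k) = 0 := by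
  rw [inv_r, r_mul_r, r_pow, r_pow, r_mul_r, r_eq_one_iff]
  ring_nf

variable {n}

theorem sr_r_word_eq_one_iff (hn : Even n) :
    ((sr i : DihedralGroup k) * (r l)⁻¹) ^ n * (r l) ^ n = 1 ↔ l * (n : ZMod k) = 0 := by
  rw [inv_r, sr_mul_r, sr_pow, if_pos hn, r_pow, one_mul, r_eq_one_iff]

theorem r_sr_word_eq_one (hn : Even n) :
    ((r i : DihedralGroup k) * (sr l)⁻¹) ^ n * (sr l) ^ n = 1 := by
  rw [inv_sr, r_mul_sr, sr_pow, sr_pow, if_pos hn, if_pos hn, one_mul]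

theorem sr_sr_word_eq_one_iff (hn : Even n) :
    ((sr i : DihedralGroup k) * (sr l)⁻¹) ^ n * (sr l) ^ n = 1 ↔ (l - i) * (n : ZMod k) = 0 := by
  rw [inv_sr, sr_mul_sr, sr_pow, if_pos hn, r_pow, mul_one, r_eq_one_iff]

theorem sr_r_word_ne_one (hn : ¬ Even n) :
    ((sr i : DihedralGroup k) * (r l)⁻¹) ^ n * (r l) ^ n ≠ 1 := by
  rw [inv_r, sr_mul_r, sr_pow, if_neg hn, r_pow, sr_mul_r, DihedralGroup.one_def]
  nofun

theorem r_sr_word_eq_one_iff (hn : ¬ Even n) :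
    ((r i : DihedralGroup k) * (sr l)⁻¹) ^ n * (sr l) ^ n = 1 ↔ i = 0 := by
  rw [inv_sr, r_mul_sr, sr_pow, sr_pow, if_neg hn, if_neg hn, sr_mul_sr, sub_sub_cancel,
    r_eq_one_iff]

theorem sr_sr_word_ne_one (hn : ¬ Even n) :
    ((sr i : DihedralGroup k) * (sr l)⁻¹) ^ n * (sr l) ^ n ≠ 1 := by
  rw [inv_sr, sr_mul_sr, sr_pow, if_neg hn, r_pow, r_mul_sr, DihedralGroup.one_def]
  nofun

end words

/-- For odd n the only surviving reflection terms are the χ(e_1 s), s a reflection, whatever n is.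
Subtracting the formula for ν_1 = χ(Λ), a rank, leaves k times the sum of ranks over the nonzero
n-torsion pairs. Negation has no fixed point there, so that sum is even. -/
theorem exists_fsIndicator_of_odd {k : ℕ} [NeZero k] (φ : DihedralGroup k ≃* G)
    (V : Type*) [AddCommGroup V] [Module ℂ V] [FiniteDimensional ℂ V]
    [Module (DrinfeldDouble G) V] [IsScalarTower ℂ (DrinfeldDouble G) V]
    {n : ℕ} (hn : Odd n) : ∃ z : ℤ, fsIndicator G n V = z := by
  classical
  have hk : (k : ℂ) ≠ 0 := NeZero.ne _
  have hne : ¬ Even n := Nat.not_even_iff_odd.2 hn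
  choose M hM using fun i j =>
    character_of_isIdempotentElem V (rotationIdempotent_isIdempotentElem φ i j)
  obtain ⟨N, hN⟩ := character_of_isIdempotentElem V (p := integral G) <| by
    rw [IsIdempotentElem, integral_spec.1, integral_spec.2.2, one_smul]
  have hMneg : ∀ i j, M (-i) (-j) = M i j := fun i j => by
    have := character_rotationIdempotent_neg φ V i j
    rw [hM, hM] at this
    exact_mod_cast this
  have hν := two_mul_card_mul_fsIndicator φ V n
  have hν1 := two_mul_card_mul_fsIndicator φ V 1
  have hN1 : fsIndicator G 1 V = N := by
    rw [← hN, fsIndicator_eq_character, sweedlerPow_integral]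
    simp [integral]
  simp only [DihedralGroup.sum_eq, r_r_word_eq_one_iff, sr_r_word_ne_one _ _ hne,
    r_sr_word_eq_one_iff _ _ hne, sr_sr_word_ne_one _ _ hne, sr_r_word_ne_one _ _ Nat.not_even_one,
    r_sr_word_eq_one_iff _ _ Nat.not_even_one, sr_sr_word_ne_one _ _ Nat.not_even_one,
    if_false, Finset.sum_const_zero, add_zero, Finset.sum_add_distrib] at hν hν1
  simp only [r_pow, sr_pow, hne, Nat.not_even_one, if_false, Finset.sum_ite_eq', Finset.mem_univ,
    if_true] at hν hν1
  rw [sum_rotation_terms] at hν hν1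
  have hodd : ∃ q, ∑ p ∈ torsionPairs k n, M p.1 p.2 = q + q + M 0 0 := by
    have h0 : (0 : ZMod k × ZMod k) ∈ torsionPairs k n := by simp [mem_torsionPairs]
    obtain ⟨q, hq⟩ := even_sum_of_involution ((torsionPairs k n).erase 0)
      (fun p => M p.1 p.2) (fun p => -p)
      (fun p hp => by
        rw [Finset.mem_erase] at hp ⊢
        exact ⟨neg_ne_zero.2 hp.1, (neg_mem_torsionPairs p).2 hp.2⟩)
      (fun p hp hpe => by
        rw [Finset.mem_erase, mem_torsionPairs] at hp
        obtain ⟨h1, h2⟩ := mem_torsionPairs_two_of_neg_eq hpe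
        obtain ⟨c, rfl⟩ := hn
        push_cast at hp
        have h3 : p.1 = 0 := by linear_combination hp.2.1 - c * h1
        have h4 : p.2 = 0 := by linear_combination hp.2.2 - c * h2
        exact hp.1 (Prod.ext h3 h4))
      (fun p _ => neg_neg p) (fun p _ => hMneg _ _)
    refine ⟨q, ?_⟩
    rw [← hq, ← Finset.sum_erase_add _ _ h0]
    rfl
  have hone : torsionPairs k 1 = {0} := by
    ext p
    simp [mem_torsionPairs, Prod.ext_iff]
  obtain ⟨q, hq⟩ := hodd
  simp only [hM, ← Nat.cast_sum, hq, hone, Finset.sum_singleton, Prod.fst_zero, Prod.snd_zero,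
    hN1] at hν hν1
  refine ⟨q + N, mul_left_cancel₀ (mul_ne_zero two_ne_zero hk) ?_⟩
  push_cast at hν hν1 ⊢
  linear_combination hν - hν1

/-- For even n the four types of pairs contribute k times, respectively, the ranks over n-torsion
pairs, the ranks over all pairs, and an integer z twice. The first two agree modulo 2: a pair fixed
by negation is 2-torsion, hence n-torsion, so negation acts freely on the complement. -/
theorem exists_fsIndicator_of_even {k : ℕ} [NeZero k] (φ : DihedralGroup k ≃* G)
    (V : Type*) [AddCommGroup V] [Module ℂ V] [FiniteDimensional ℂ V]
    [Module (DrinfeldDouble G) V] [IsScalarTower ℂ (DrinfeldDouble G) V]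
    {n : ℕ} (hn : Even n) : ∃ z : ℤ, fsIndicator G n V = z := by
  classical
  have hk : (k : ℂ) ≠ 0 := NeZero.ne _
  choose M hM using fun i j =>
    character_of_isIdempotentElem V (rotationIdempotent_isIdempotentElem φ i j)
  choose w hw using fun i : ZMod k =>
    character_of_isIdempotentElem V (p := e (φ (sr i)) 1) (by
      rw [IsIdempotentElem, e_mul_e_self _ _ _ (Commute.one_left _), one_mul])
  have hMneg : ∀ i j, M (-i) (-j) = M i j := fun i j => by
    have := character_rotationIdempotent_neg φ V i j
    rw [hM, hM] at this
    exact_mod_cast this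
  obtain ⟨z, hz⟩ := dvd_card_mul_sum (k := k) n hn w fun i => by
    have := character_reflection_add_two φ V i
    rw [hw, hw] at this
    exact_mod_cast this
  have hν := two_mul_card_mul_fsIndicator φ V n
  -- When x is a reflection, xⁿ = 1 and every rotation b qualifies. These terms form exactly the
  -- rotation sum for n = 0.
  have h0 := sum_rotation_terms φ V 0
  have hS1 : (∑ l : ZMod k, ∑ i : ZMod k, if l * n = 0 then
      character G V (e (φ (sr i)) (φ (r (l * n)))) else 0) = k * z := by
    have : ∀ l : ZMod k, (∑ i : ZMod k, if l * n = 0 then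
      character G V (e (φ (sr i)) (φ (r (l * n)))) else 0) =
        if l * n = 0 then ((∑ i, w i : ℕ) : ℂ) else 0 := fun l => by
      split_ifs with h
      · simp [h, r_zero, hw]
      · simp
    simp only [this]
    rw [← Finset.sum_filter, Finset.sum_const, nsmul_eq_mul]
    exact_mod_cast hz
  have hS2 : (∑ l : ZMod k, ∑ i : ZMod k, if (l - i) * n = 0 then
      character G V (e (φ (sr i)) 1) else 0) = k * z := by
    rw [Finset.sum_comm]
    have : ∀ i : ZMod k, (∑ l : ZMod k, if (l - i) * n = 0 then
      character G V (e (φ (sr i)) 1) else 0) =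
        (Finset.univ.filter fun l : ZMod k => l * n = 0).card * (w i : ℂ) := fun i => by
      rw [Fintype.sum_equiv (Equiv.subRight i)
        (fun l : ZMod k => if (l - i) * n = 0 then character G V (e (φ (sr i)) 1) else 0)
        (fun l : ZMod k => if l * n = 0 then character G V (e (φ (sr i)) 1) else 0) fun l => rfl,
        ← Finset.sum_filter, Finset.sum_const, nsmul_eq_mul, hw]
    simp only [this]
    rw [← Finset.mul_sum]
    exact_mod_cast hz
  simp only [DihedralGroup.sum_eq, r_r_word_eq_one_iff, sr_r_word_eq_one_iff _ _ hn,
    r_sr_word_eq_one _ _ hn, sr_sr_word_eq_one_iff _ _ hn, Finset.sum_add_distrib] at hν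
  simp only [r_pow, sr_pow, hn, if_true, map_one] at hν
  rw [sum_rotation_terms, hS1, hS2] at hν
  simp only [Nat.cast_zero, mul_zero, if_true, r_zero, map_one] at h0
  rw [h0] at hν
  have huniv : torsionPairs k 0 = Finset.univ := by
    ext p
    simp [mem_torsionPairs]
  have hodd : ∃ q, ∑ p : ZMod k × ZMod k, M p.1 p.2 =
      ∑ p ∈ torsionPairs k n, M p.1 p.2 + (q + q) := by
    obtain ⟨q, hq⟩ := even_sum_of_involution (torsionPairs k n)ᶜ
      (fun p => M p.1 p.2) (fun p => -p)
      (fun p hp => by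
        rw [Finset.mem_compl] at hp ⊢
        rwa [neg_mem_torsionPairs])
      (fun p hp hpe => by
        rw [Finset.mem_compl, mem_torsionPairs] at hp
        obtain ⟨h1, h2⟩ := mem_torsionPairs_two_of_neg_eq hpe
        obtain ⟨c, rfl⟩ := hn
        push_cast at hp
        exact hp ⟨by linear_combination c * h1, by linear_combination c * h2⟩)
      (fun p _ => neg_neg p) (fun p _ => hMneg _ _)
    exact ⟨q, by rw [← hq, Finset.sum_add_sum_compl]⟩
  obtain ⟨q, hq⟩ := hodd
  simp only [hM, ← Nat.cast_sum, huniv, hq] at hν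
  refine ⟨(∑ p ∈ torsionPairs k n, M p.1 p.2 : ℕ) + q + z,
    mul_left_cancel₀ (mul_ne_zero two_ne_zero hk) ?_⟩
  rw [hν]
  push_cast
  ring

end DrinfeldDouble

theorem isFSZ_of_isDihedral (D : Type*) [Group D] [Fintype D] (hD : IsDihedral D) :
    IsFSZ D := by
  obtain ⟨k, hk, ⟨φ⟩⟩ := hD
  have : NeZero k := ⟨hk.ne'⟩
  intro n _ V _ _ _ _ _ _
  rcases Nat.even_or_odd n with hn | hn
  · exact DrinfeldDouble.exists_fsIndicator_of_even φ.symm V hn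
  · exact DrinfeldDouble.exists_fsIndicator_of_odd φ.symm V hn

/-! ### Recognizing dihedral groups. -/

/-- A finite group with a cyclic subgroup of index two generated by `r`, and an involution `s`
outside it that inverts `r`, is dihedral. -/
theorem isDihedral_of_cyclic_of_involution {G : Type*} [Group G] [Finite G] (r s : G)
    (hs : s * s = 1) (hsr : s * r * s = r⁻¹) (hmem : s ∉ Subgroup.zpowers r)
    (hG : ∀ g, g ∈ Subgroup.zpowers r ∨ s * g ∈ Subgroup.zpowers r) : IsDihedral G := by
  set n := Nat.card (Subgroup.zpowers r)
  have hn : 0 < n := Nat.card_pos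
  let r' : Subgroup.zpowers r := ⟨r, Subgroup.mem_zpowers r⟩
  have hr' : ∀ x, x ∈ Subgroup.zpowers r' := by
    rintro ⟨x, i, rfl⟩
    exact ⟨i, Subtype.ext (by simp [r'])⟩
  let φ : Multiplicative (ZMod n) ≃* Subgroup.zpowers r := zmodMulEquivOfGenerator hr' rfl
  let c : ZMod n → G := fun i => (φ (Multiplicative.ofAdd i) : G)
  have hadd : ∀ i j, c (i + j) = c i * c j := fun i j => by simp [c, ofAdd_add]
  have hmemc : ∀ i, c i ∈ Subgroup.zpowers r := fun i => (φ _).2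
  have hinj : ∀ i j, c i = c j → i = j := fun i j h =>
    Multiplicative.ofAdd.injective (φ.injective (Subtype.ext h))
  have hsurj : ∀ g ∈ Subgroup.zpowers r, ∃ i, c i = g := fun g hg =>
    ⟨Multiplicative.toAdd (φ.symm ⟨g, hg⟩), by simp [c]⟩
  have hzero : c 0 = 1 := by simp [c]
  have hneg : ∀ i, c (-i) = (c i)⁻¹ := fun i => by
    rw [eq_inv_iff_mul_eq_one, ← hadd, neg_add_cancel, hzero]
  have hsinv : s⁻¹ = s := inv_eq_of_mul_eq_one_left hs
  have hconj : ∀ i, c i * s = s * c (-i) := fun i => by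
    obtain ⟨j, hj⟩ := Subgroup.mem_zpowers_iff.1 (hmemc i)
    have h1 : s * r ^ j * s⁻¹ = (r ^ j)⁻¹ := by
      rw [← conj_zpow, hsinv, hsr, inv_zpow]
    rw [hneg, ← hj, ← h1, hsinv, ← mul_assoc, ← mul_assoc, hs, one_mul]
  let f : DihedralGroup n → G
    | .r i => c i
    | .sr i => s * c i
  have hf : ∀ x y, f (x * y) = f x * f y := by
    rintro (i | i) (j | j)
    · simp only [DihedralGroup.r_mul_r, f, hadd]
    · simp only [DihedralGroup.r_mul_sr, f]
      rw [← mul_assoc, hconj, mul_assoc, ← hadd, sub_eq_neg_add]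
    · simp only [DihedralGroup.sr_mul_r, f, hadd, mul_assoc]
    · simp only [DihedralGroup.sr_mul_sr, f]
      rw [mul_assoc, ← mul_assoc (c i), hconj, mul_assoc, ← hadd, ← mul_assoc, hs, one_mul,
        sub_eq_neg_add]
  have hns : ∀ i j, c i ≠ s * c j := fun i j h => hmem <| by
    rw [← mul_inv_eq_iff_eq_mul] at h
    rw [← h]
    exact mul_mem (hmemc i) (inv_mem (hmemc j))
  have hbij : Function.Bijective f := by
    constructor
    · rintro (i | i) (j | j) h
      · rw [hinj i j h]
      · exact absurd h (hns i j)
      · exact absurd h.symm (hns j i)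
      · rw [hinj i j (mul_left_cancel h)]
    · intro g
      rcases hG g with hg | hg
      · obtain ⟨i, hi⟩ := hsurj g hg
        exact ⟨.r i, hi⟩
      · obtain ⟨i, hi⟩ := hsurj _ hg
        refine ⟨.sr i, ?_⟩
        simp only [f, hi]
        rw [← mul_assoc, hs, one_mul]
  exact ⟨n, hn, ⟨(MulEquiv.ofBijective (MulHom.mk f hf) hbij).symm⟩⟩

/-! ### A criterion for FSZ⁺. -/

/-- A conjugation-equivariant bijection of sets gives an isomorphism of permutation modules. -/
theorem nonempty_permRep_equiv {G : Type*} [Group G] (K : Subgroup G) (S T : Set G)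
    (hS : ∀ h ∈ K, ∀ a ∈ S, h * a * h⁻¹ ∈ S) (hT : ∀ h ∈ K, ∀ a ∈ T, h * a * h⁻¹ ∈ T)
    (ε : S ≃ T) (hε : ∀ h (hh : h ∈ K) (a : S),
      (ε ⟨h * a * h⁻¹, hS h hh a a.2⟩ : G) = h * ε a * h⁻¹) :
    Nonempty ((permRep K S hS).Equiv (permRep K T hT)) := by
  refine ⟨.mk (MonoidAlgebra.mapDomainLinearEquiv ℂ ℂ ε) fun g => ?_⟩
  refine MonoidAlgebra.lhom_ext' fun a => LinearMap.ext fun c => ?_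
  let := conjActionOn K S hS
  let := conjActionOn K T hT
  simp only [permRep, LinearMap.comp_apply, LinearEquiv.coe_coe, MonoidAlgebra.lsingle_apply,
    Representation.ofMulAction_single, MonoidAlgebra.mapDomainLinearEquiv_single]
  congr 1
  exact Subtype.ext (hε g g.2 a)

/-- When a and u commute, (a u⁻¹)ⁿ = aⁿ just says uⁿ = 1, a condition that survives replacing a by a
power. -/
theorem zpow_mem_gSet {G : Type*} [Group G] {n : ℕ} {u g a : G} (ha : a ∈ gSet n u g)
    (hau : Commute a u) (m : ℤ) : a ^ m ∈ gSet n u (g ^ m) := by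
  obtain ⟨h1, h2⟩ := ha
  have hun : u ^ n = 1 := by
    rw [hau.inv_right.mul_pow, mul_eq_left, inv_pow, inv_eq_one] at h1
    exact h1
  have h3 : (a ^ m) ^ n = g ^ m := by
    rw [← h2, ← zpow_natCast, ← zpow_natCast, zpow_comm]
  refine ⟨?_, h3⟩
  rw [(hau.zpow_left m).inv_right.mul_pow, inv_pow, hun, inv_one, mul_one]

/-- A finite group in which every element of order greater than two has an abelian centralizer is
an `FSZ⁺`-group. -/
theorem isFSZPlus_of_centralizer {G : Type*} [Group G] [Finite G]
    (h : ∀ g : G, g ^ 2 = 1 ∨ ∀ a b : G, Commute a g → Commute b g → Commute a b) :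
    IsFSZPlus G := by
  intro n _ u g hug m hm
  by_cases hg : g ^ m = g
  · refine nonempty_permRep_equiv _ _ _ _ _ (Equiv.setCongr (by rw [hg])) fun k hk a => rfl
  -- If g had order 2, then |G| would be even and m odd, giving g^m = g.
  have hcomm : ∀ a b : G, Commute a g → Commute b g → Commute a b := by
    refine (h g).resolve_left fun hg2 => hg ?_
    by_cases hg1 : g = 1
    · rw [hg1, one_zpow]
    have ho : orderOf g = 2 := orderOf_eq_prime hg2 hg1
    have h2 : (2 : ℤ) ∣ Nat.card G := by
      have := orderOf_dvd_natCard g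
      rw [ho] at this
      exact_mod_cast this
    have hodd : Odd m := Int.isCoprime_two_right.1 (hm.of_isCoprime_of_dvd_right h2)
    obtain ⟨c, rfl⟩ := hodd
    have hg2' : g ^ (2 : ℤ) = 1 := by exact_mod_cast hg2
    rw [zpow_add, zpow_mul, hg2', one_zpow, one_mul, zpow_one]
  -- The Bézout coefficient m' inverts m modulo |G|, so the m'-th power map undoes the m-th.
  obtain ⟨m', c, hm'⟩ := hm
  have hpow : ∀ a : G, (a ^ m) ^ m' = a := fun a => by
    rw [← zpow_mul]
    have : m * m' = 1 - Nat.card G * c := by linear_combination hm'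
    rw [this, zpow_sub, zpow_one, zpow_mul, zpow_natCast, pow_card_eq_one', one_zpow, inv_one,
      mul_one]
  have hpow' : ∀ a : G, (a ^ m') ^ m = a := fun a => by rw [zpow_comm, hpow]
  -- Since g = aⁿ, both a and u lie in the abelian centralizer of g. The same holds for G_n(u, g^m),
  -- as g is a power of g^m.
  have h1 : ∀ a ∈ gSet n u g, Commute a u := fun a ha =>
    hcomm a u (ha.2 ▸ Commute.self_pow a n) hug
  have h2 : ∀ a ∈ gSet n u (g ^ m), Commute a u := fun a ha => by
    refine hcomm a u ?_ hug
    have : Commute a (g ^ m) := ha.2 ▸ Commute.self_pow a n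
    simpa only [hpow] using this.zpow_right m'
  refine nonempty_permRep_equiv _ _ _ _ _
    { toFun := fun a => ⟨a ^ m, zpow_mem_gSet a.2 (h1 a a.2) m⟩
      invFun := fun a => ⟨a ^ m', by
        simpa only [hpow] using zpow_mem_gSet a.2 (h2 a a.2) m'⟩
      left_inv := fun a => Subtype.ext (hpow a)
      right_inv := fun a => Subtype.ext (hpow' a) } fun k hk a => ?_
  exact conj_zpow

/-! ### Commuting and anticommuting elements of SL_2. -/

namespace Matrix.SpecialLinearGroup

variable {F : Type*} [Field F]

theorem exists_smul_of_commute_fin_two {a b c p q r : F} (hne : ¬(p = 0 ∧ q = 0 ∧ r = 0))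
    (h1 : a * q = b * p) (h2 : a * r = c * p) (h3 : b * r = c * q) :
    ∃ t, a = t * p ∧ b = t * q ∧ c = t * r := by
  by_cases hp : p = 0
  · by_cases hq : q = 0
    · have hr : r ≠ 0 := fun hr => hne ⟨hp, hq, hr⟩
      refine ⟨c / r, ?_, ?_, ?_⟩ <;> field_simp <;> simp_all
    · refine ⟨b / q, ?_, ?_, ?_⟩ <;> field_simp <;> simp_all
  · refine ⟨a / p, ?_, ?_, ?_⟩ <;> field_simp <;> simp_all

/-- Scalars do not affect commutation, so only the trace-free parts, with coordinates (A₀₁, A₁₀, A₀₀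
- A₁₁), matter. The commutator vanishes exactly when these vectors have zero 2×2 minors. -/
theorem commute_fin_two_iff (A B : SpecialLinearGroup (Fin 2) F) :
    Commute A B ↔ A 0 1 * B 1 0 = A 1 0 * B 0 1 ∧
      A 0 1 * (B 0 0 - B 1 1) = (A 0 0 - A 1 1) * B 0 1 ∧
      A 1 0 * (B 0 0 - B 1 1) = (A 0 0 - A 1 1) * B 1 0 := by
  rw [Commute, SemiconjBy, ext_iff]
  simp only [Fin.forall_fin_two, coe_mul, Matrix.mul_apply, Fin.sum_univ_two]
  constructor
  · rintro ⟨⟨h1, h2⟩, h3, h4⟩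
    refine ⟨by linear_combination h1, by linear_combination -h2, by linear_combination h3⟩
  · rintro ⟨h1, h2, h3⟩
    refine ⟨⟨by linear_combination h1, by linear_combination -h2⟩, by linear_combination h3,
      by linear_combination -h1⟩

theorem mem_center_fin_two_iff (A : SpecialLinearGroup (Fin 2) F) :
    A ∈ Subgroup.center (SpecialLinearGroup (Fin 2) F) ↔
      A 0 1 = 0 ∧ A 1 0 = 0 ∧ A 0 0 - A 1 1 = 0 := by
  rw [mem_center_iff]
  have hdet := A.det_coe
  rw [Matrix.det_fin_two] at hdet
  constructor
  · rintro ⟨r, -, hr⟩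
    simp [← hr]
  · rintro ⟨h1, h2, h3⟩
    refine ⟨A 0 0, ?_, ?_⟩
    · rw [Fintype.card_fin]
      linear_combination hdet + A 0 0 * h3 + A 1 0 * h1
    · ext i j
      fin_cases i <;> fin_cases j <;> simp [h1, h2, sub_eq_zero.1 h3]

/-- The centralizer of a noncentral element of `SL_2(F)` is abelian. -/
theorem commute_of_commute_of_notMem_center {X A B : SpecialLinearGroup (Fin 2) F}
    (hX : X ∉ Subgroup.center (SpecialLinearGroup (Fin 2) F)) (hA : Commute A X)
    (hB : Commute B X) : Commute A B := by
  rw [mem_center_fin_two_iff] at hX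
  rw [commute_fin_two_iff] at hA hB ⊢
  obtain ⟨s, hs1, hs2, hs3⟩ := exists_smul_of_commute_fin_two hX hA.1 hA.2.1 hA.2.2
  obtain ⟨t, ht1, ht2, ht3⟩ := exists_smul_of_commute_fin_two hX hB.1 hB.2.1 hB.2.2
  rw [hs1, hs2, hs3, ht1, ht2, ht3]
  refine ⟨by ring, by ring, by ring⟩

theorem mk_eq_mk_iff_fin_two (A B : SpecialLinearGroup (Fin 2) F) :
    (QuotientGroup.mk A : ProjectiveSpecialLinearGroup (Fin 2) F) = QuotientGroup.mk B ↔
      A = B ∨ A = -B := by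
  rw [QuotientGroup.eq, mem_center_iff]
  constructor
  · rintro ⟨r, hr, h⟩
    have hB : (B : Matrix (Fin 2) (Fin 2) F) = A * scalar (Fin 2) r := by
      rw [h, ← coe_mul, mul_inv_cancel_left]
    rw [Fintype.card_fin, sq_eq_one_iff] at hr
    rcases hr with rfl | rfl
    · left
      exact Subtype.ext (by simpa using hB.symm)
    · right
      refine Subtype.ext ?_
      rw [coe_neg, hB, map_neg, map_one, mul_neg, mul_one, neg_neg]
  · rintro (rfl | rfl)
    · exact ⟨1, by simp⟩
    · refine ⟨-1, by simp, ?_⟩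
      rw [show (-B)⁻¹ * B = -1 by rw [inv_neg]; simp, map_neg, map_one, coe_neg, coe_one]

theorem mk_commute_mk_iff_fin_two (A B : SpecialLinearGroup (Fin 2) F) :
    Commute (QuotientGroup.mk A : ProjectiveSpecialLinearGroup (Fin 2) F) (QuotientGroup.mk B) ↔
      Commute A B ∨ A * B = -(B * A) := by
  rw [Commute, SemiconjBy, ← QuotientGroup.mk_mul, ← QuotientGroup.mk_mul, mk_eq_mk_iff_fin_two]
  rfl

/-- X is conjugate to -X, so its trace equals its own negative. -/
theorem two_mul_trace_eq_zero {A X : SpecialLinearGroup (Fin 2) F} (h : A * X = -(X * A)) :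
    2 * (X 0 0 + X 1 1) = 0 := by
  have h1 : (X : Matrix (Fin 2) (Fin 2) F) = -(A⁻¹ * X * A : SpecialLinearGroup (Fin 2) F) := by
    rw [← coe_neg]
    congr 1
    rw [mul_assoc, neg_eq_iff_eq_neg.1 h.symm, mul_neg, inv_mul_cancel_left, neg_neg]
  have h2 := congrArg Matrix.trace h1
  rw [trace_neg, coe_mul, trace_mul_comm, ← coe_mul, mul_inv_cancel_left, trace_fin_two] at h2
  linear_combination h2

theorem mul_self_of_trace_eq_zero {X : SpecialLinearGroup (Fin 2) F} (h : X 0 0 + X 1 1 = 0) :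
    X * X = -1 := by
  have hdet := X.det_coe
  rw [Matrix.det_fin_two] at hdet
  ext i j
  fin_cases i <;> fin_cases j <;> simp [Matrix.mul_apply, Fin.sum_univ_two]
  · linear_combination X 0 0 * h - hdet
  · linear_combination X 0 1 * h
  · linear_combination X 1 0 * h
  · linear_combination X 1 1 * h - hdet

/-- The centralizer in `SL_2(F)` of an element of trace zero is cyclic, for a finite field `F` of
odd characteristic. -/
theorem isCyclic_centralizer_of_trace_eq_zero [Finite F] (h2 : (2 : F) ≠ 0)
    {X : SpecialLinearGroup (Fin 2) F} (hX : X 0 0 + X 1 1 = 0) :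
    IsCyclic (Subgroup.centralizer {X}) := by
  have hdet := X.det_coe
  rw [Matrix.det_fin_two] at hdet
  have hXc : X ∉ Subgroup.center (SpecialLinearGroup (Fin 2) F) := by
    rw [mem_center_fin_two_iff]
    rintro ⟨h01, -, h3⟩
    have h0 : 2 * X 0 0 = 0 := by linear_combination hX + h3
    have h00 : X 0 0 = 0 := (mul_eq_zero.1 h0).resolve_left h2
    rw [h01, h00] at hdet
    simp at hdet
  -- The centralizer consists of the matrices a + bX. As X² = -1, their determinant is a² + b², and
  -- a + bX ↦ a + ib will embed it in a field.
  have hform : ∀ Y : SpecialLinearGroup (Fin 2) F, Commute Y X → ∃ a b : F,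
      Y 0 0 = a + b * X 0 0 ∧ Y 0 1 = b * X 0 1 ∧ Y 1 0 = b * X 1 0 ∧ Y 1 1 = a - b * X 0 0 := by
    intro Y hY
    rw [commute_fin_two_iff] at hY
    rw [mem_center_fin_two_iff] at hXc
    obtain ⟨t, ht1, ht2, ht3⟩ := exists_smul_of_commute_fin_two hXc hY.1 hY.2.1 hY.2.2
    refine ⟨Y 0 0 - t * X 0 0, t, by ring, ht1, ht2, ?_⟩
    linear_combination t * hX - ht3
  obtain ⟨i, hi⟩ := IsAlgClosed.exists_pow_nat_eq (-1 : AlgebraicClosure F) two_pos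
  let ι := algebraMap F (AlgebraicClosure F)
  -- The coordinates are read off by traces: a = tr(Y)/2 and b = -tr(YX)/2.
  let f : SpecialLinearGroup (Fin 2) F → AlgebraicClosure F := fun Y =>
    ι ((Y 0 0 + Y 1 1) / 2) - i * ι ((Y 0 0 * X 0 0 + Y 0 1 * X 1 0 + Y 1 0 * X 0 1 +
      Y 1 1 * X 1 1) / 2)
  have hX11 : X 1 1 = - X 0 0 := by linear_combination hX
  have hsq : X 0 0 * X 0 0 + X 0 1 * X 1 0 = -1 := by
    rw [hX11] at hdet
    linear_combination -hdet
  have hf : ∀ (Y : SpecialLinearGroup (Fin 2) F) (a b : F),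
      Y 0 0 = a + b * X 0 0 → Y 0 1 = b * X 0 1 → Y 1 0 = b * X 1 0 → Y 1 1 = a - b * X 0 0 →
      f Y = ι a + i * ι b := by
    intro Y a b h00 h01 h10 h11
    have e1 : (Y 0 0 + Y 1 1) / 2 = a := by
      rw [h00, h11]
      field_simp
      ring
    have e2 : (Y 0 0 * X 0 0 + Y 0 1 * X 1 0 + Y 1 0 * X 0 1 + Y 1 1 * X 1 1) / 2 = -b := by
      rw [h00, h01, h10, h11, hX11]
      field_simp
      linear_combination 2 * b * hsq
    simp only [f, e1, e2, map_neg]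
    ring
  have hnorm : ∀ (Y : SpecialLinearGroup (Fin 2) F) (a b : F),
      Y 0 0 = a + b * X 0 0 → Y 0 1 = b * X 0 1 → Y 1 0 = b * X 1 0 → Y 1 1 = a - b * X 0 0 →
      a ^ 2 + b ^ 2 = 1 := by
    intro Y a b h00 h01 h10 h11
    have hdetY := Y.det_coe
    rw [Matrix.det_fin_two, h00, h01, h10, h11] at hdetY
    linear_combination hdetY + b ^ 2 * hsq
  have hcomm : ∀ Y : Subgroup.centralizer {X}, Commute (Y : SpecialLinearGroup (Fin 2) F) X :=
    fun Y => Subgroup.mem_centralizer_singleton_iff.1 Y.2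
  let f' : Subgroup.centralizer {X} →* AlgebraicClosure F :=
    { toFun := fun Y => f Y
      map_one' := by
        rw [hf _ 1 0 (by simp) (by simp) (by simp) (by simp)]
        simp
      map_mul' := fun Y Z => by
        obtain ⟨a, b, y1, y2, y3, y4⟩ := hform Y (hcomm Y)
        obtain ⟨c, d, z1, z2, z3, z4⟩ := hform Z (hcomm Z)
        rw [hf _ a b y1 y2 y3 y4, hf _ c d z1 z2 z3 z4,
          hf _ (a * c - b * d) (a * d + b * c)]
        · simp only [map_sub, map_add, map_mul]
          linear_combination (-ι b * ι d) * hi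
        all_goals
          simp only [Subgroup.coe_mul, coe_mul, Matrix.mul_apply, Fin.sum_univ_two, y1, y2, y3, y4,
            z1, z2, z3, z4]
        · linear_combination b * d * hsq
        · ring
        · ring
        · linear_combination b * d * hsq }
  refine isCyclic_of_injective_ringHom f' fun Y Z hYZ => ?_
  obtain ⟨a, b, y1, y2, y3, y4⟩ := hform Y (hcomm Y)
  obtain ⟨c, d, z1, z2, z3, z4⟩ := hform Z (hcomm Z)
  have hY := congrArg ι (hnorm _ a b y1 y2 y3 y4)
  have hZ := congrArg ι (hnorm _ c d z1 z2 z3 z4)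
  have h : f Y = f Z := hYZ
  rw [hf _ a b y1 y2 y3 y4, hf _ c d z1 z2 z3 z4] at h
  simp only [map_add, map_pow, map_one] at hY hZ
  -- If i lies in F, then a + ib alone does not determine a and b. Determinant one makes a - ib its
  -- inverse, so both values are known, and 2 and i are invertible.
  have hY' : (ι a + i * ι b) * (ι a - i * ι b) = 1 := by linear_combination hY - ι b ^ 2 * hi
  have hZ' : (ι a + i * ι b) * (ι c - i * ι d) = 1 := by
    rw [h]
    linear_combination hZ - ι d ^ 2 * hi
  have hne : ι a + i * ι b ≠ 0 := fun h0 => by simp [h0] at hY'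
  have h' := mul_left_cancel₀ hne (hY'.trans hZ'.symm)
  have h2' : (2 : AlgebraicClosure F) ≠ 0 := by
    rw [← map_ofNat ι 2]
    exact (map_ne_zero ι).2 h2
  have hi0 : i ≠ 0 := by
    rintro rfl
    simp at hi
  have hac : a = c := ι.injective (mul_left_cancel₀ h2' (by linear_combination h + h'))
  have hbd : b = d :=
    ι.injective (mul_left_cancel₀ (mul_ne_zero h2' hi0) (by linear_combination h - h'))
  subst hac hbd
  refine Subtype.ext (SpecialLinearGroup.ext _ _ ?_)
  simp only [Fin.forall_fin_two]
  exact ⟨⟨y1.trans z1.symm, y2.trans z2.symm⟩, y3.trans z3.symm, y4.trans z4.symm⟩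

end Matrix.SpecialLinearGroup

/-! ### Centralizers in PSL_2 and FSZ⁺. -/

namespace Matrix.ProjectiveSpecialLinearGroup

open Matrix.SpecialLinearGroup

variable {F : Type*} [Field F]

theorem mk_ne_one_iff (X : SpecialLinearGroup (Fin 2) F) :
    (QuotientGroup.mk X : ProjectiveSpecialLinearGroup (Fin 2) F) ≠ 1 ↔
      X ∉ Subgroup.center (SpecialLinearGroup (Fin 2) F) :=
  (QuotientGroup.eq_one_iff X).not

/-- The centralizer in `PSL_2(F)` of a nonidentity element that is not the image of an element of
trace zero is abelian; in characteristic two there is no condition on the trace. -/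
theorem commute_of_commute_of_two_mul_trace_ne_zero {X : SpecialLinearGroup (Fin 2) F}
    (hX : X ∉ Subgroup.center (SpecialLinearGroup (Fin 2) F))
    (h : X 0 0 + X 1 1 ≠ 0 ∨ (2 : F) = 0) {a b : ProjectiveSpecialLinearGroup (Fin 2) F}
    (ha : Commute a (QuotientGroup.mk X)) (hb : Commute b (QuotientGroup.mk X)) :
    Commute a b := by
  have key : ∀ A : SpecialLinearGroup (Fin 2) F,
      Commute (QuotientGroup.mk A : ProjectiveSpecialLinearGroup (Fin 2) F) (QuotientGroup.mk X) →
        Commute A X := by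
    intro A hA
    rcases (mk_commute_mk_iff_fin_two A X).1 hA with hA | hA
    · exact hA
    · have h2 : (2 : F) = 0 := by
        rcases h with h | h
        · exact (mul_eq_zero.1 (two_mul_trace_eq_zero hA)).resolve_right h
        · exact h
      have hneg : ∀ t : F, -t = t := fun t => by linear_combination -t * h2
      refine hA.trans (SpecialLinearGroup.ext _ _ fun i j => ?_)
      simp only [coe_neg, Matrix.neg_apply, hneg]
  obtain ⟨A, rfl⟩ := QuotientGroup.mk_surjective a
  obtain ⟨B, rfl⟩ := QuotientGroup.mk_surjective b
  exact (mk_commute_mk_iff_fin_two A B).2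
    (.inl (commute_of_commute_of_notMem_center hX (key A ha) (key B hb)))

theorem mk_mul_self_of_trace_eq_zero {X : SpecialLinearGroup (Fin 2) F}
    (hX : X 0 0 + X 1 1 = 0) :
    (QuotientGroup.mk X : ProjectiveSpecialLinearGroup (Fin 2) F) * QuotientGroup.mk X = 1 := by
  rw [← QuotientGroup.mk_mul, mul_self_of_trace_eq_zero hX, ← QuotientGroup.mk_one,
    mk_eq_mk_iff_fin_two]
  exact .inr rfl

/-- The centralizer is the image of the A with AX = ±XA. Those with sign + form a cyclic group
generated by some R. If no sign - occurs, the image is abelian; otherwise any anticommuting S has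
trace zero, so S² = -1 and S becomes the required involution. -/
theorem isMulCommutative_or_isDihedral_of_trace_eq_zero [Finite F] (h2 : (2 : F) ≠ 0)
    {X : SpecialLinearGroup (Fin 2) F} (hX : X 0 0 + X 1 1 = 0) :
    IsMulCommutative (Subgroup.centralizer
      {(QuotientGroup.mk X : ProjectiveSpecialLinearGroup (Fin 2) F)}) ∨
    IsDihedral (Subgroup.centralizer
      {(QuotientGroup.mk X : ProjectiveSpecialLinearGroup (Fin 2) F)}) := by
  set C := Subgroup.centralizer {(QuotientGroup.mk X : ProjectiveSpecialLinearGroup (Fin 2) F)}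
  have hmem : ∀ A : SpecialLinearGroup (Fin 2) F,
      (QuotientGroup.mk A : ProjectiveSpecialLinearGroup (Fin 2) F) ∈ C ↔
        Commute A X ∨ A * X = -(X * A) := fun A => by
    rw [Subgroup.mem_centralizer_singleton_iff]
    exact mk_commute_mk_iff_fin_two A X
  obtain ⟨⟨R, hR⟩, hgen⟩ := (isCyclic_centralizer_of_trace_eq_zero h2 hX).exists_generator
  have hgen' : ∀ A : SpecialLinearGroup (Fin 2) F, Commute A X → ∃ i : ℤ, R ^ i = A := by
    intro A hA
    obtain ⟨i, hi⟩ := hgen ⟨A, Subgroup.mem_centralizer_singleton_iff.2 hA⟩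
    exact ⟨i, congrArg Subtype.val hi⟩
  have hRX : Commute R X := Subgroup.mem_centralizer_singleton_iff.1 hR
  by_cases hS : ∃ S : SpecialLinearGroup (Fin 2) F, S * X = -(X * S)
  swap
  · left
    refine ⟨⟨?_⟩⟩
    rintro ⟨a, ha⟩ ⟨b, hb⟩
    obtain ⟨A, rfl⟩ := QuotientGroup.mk_surjective a
    obtain ⟨B, rfl⟩ := QuotientGroup.mk_surjective b
    obtain ⟨i, rfl⟩ := hgen' A (((hmem A).1 ha).resolve_right fun h => hS ⟨A, h⟩)
    obtain ⟨j, rfl⟩ := hgen' B (((hmem B).1 hb).resolve_right fun h => hS ⟨B, h⟩)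
    refine Subtype.ext ?_
    exact congrArg QuotientGroup.mk ((Commute.refl R).zpow_zpow i j).eq
  right
  obtain ⟨S, hS⟩ := hS
  have hnegne : ∀ A : SpecialLinearGroup (Fin 2) F, A ≠ -A := by
    intro A hA
    have h1 : (1 : SpecialLinearGroup (Fin 2) F) = -1 := by
      simpa using congrArg (A⁻¹ * ·) hA
    have h3 : (1 : F) = -1 := by
      simpa using congrArg (fun M : SpecialLinearGroup (Fin 2) F => M 0 0) h1
    exact h2 (by linear_combination h3)
  have hStr : S 0 0 + S 1 1 = 0 := by
    have : X * S = -(S * X) := by rw [hS, neg_neg]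
    exact (mul_eq_zero.1 (two_mul_trace_eq_zero this)).resolve_left h2
  have hanti : ∀ A : SpecialLinearGroup (Fin 2) F, A * X = -(X * A) → Commute (S * A) X := by
    intro A hA
    rw [Commute, SemiconjBy, mul_assoc, hA, mul_neg, ← mul_assoc, hS, neg_mul, neg_neg, mul_assoc]
  -- SR anticommutes with X as well, so it has trace zero and (SR)² = -1. Modulo signs, S inverts R.
  have hSRS : S * R * S = -R⁻¹ := by
    have h : X * (S * R) = -(S * R * X) := by
      rw [mul_assoc S, hRX.eq, ← mul_assoc S, hS, neg_mul, neg_neg, mul_assoc]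
    have := mul_self_of_trace_eq_zero (X := S * R)
      ((mul_eq_zero.1 (two_mul_trace_eq_zero h)).resolve_left h2)
    rw [← mul_assoc] at this
    rw [eq_mul_inv_of_mul_eq this, neg_mul, one_mul]
  let r : C := ⟨QuotientGroup.mk R, (hmem R).2 (.inl hRX)⟩
  let s : C := ⟨QuotientGroup.mk S, (hmem S).2 (.inr hS)⟩
  have hzpow : ∀ g : C, g ∈ Subgroup.zpowers r ↔ ∃ A, Commute A X ∧ QuotientGroup.mk A = g.1 := by
    intro g
    constructor
    · rintro ⟨i, rfl⟩
      exact ⟨R ^ i, hRX.zpow_left i, rfl⟩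
    · rintro ⟨A, hA, hg⟩
      obtain ⟨i, rfl⟩ := hgen' A hA
      exact ⟨i, Subtype.ext hg⟩
  refine isDihedral_of_cyclic_of_involution r s
    (Subtype.ext (mk_mul_self_of_trace_eq_zero hStr)) (Subtype.ext ?_) ?_ ?_
  · change QuotientGroup.mk (S * R * S) = QuotientGroup.mk (R⁻¹)
    exact (mk_eq_mk_iff_fin_two _ _).2 (.inr hSRS)
  · rw [hzpow]
    rintro ⟨A, hA, hAS⟩
    have hSX : Commute S X := by
      rcases (mk_eq_mk_iff_fin_two _ _).1 hAS with h | h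
      · rwa [← h]
      · rw [← neg_eq_iff_eq_neg] at h
        rw [← h]
        exact hA.neg_left
    exact hnegne (X * S) (hSX.eq.symm.trans hS)
  · rintro ⟨g, hg⟩
    obtain ⟨A, rfl⟩ := QuotientGroup.mk_surjective g
    rcases (hmem A).1 hg with hA | hA
    · exact .inl ((hzpow _).2 ⟨A, hA, rfl⟩)
    · exact .inr ((hzpow _).2 ⟨S * A, hanti A hA, rfl⟩)

/-- The centralizer of a nonidentity element of `PSL_2(F)` is abelian or dihedral. -/
theorem isMulCommutative_or_isDihedral_centralizer [Finite F]
    (x : ProjectiveSpecialLinearGroup (Fin 2) F) (hx : x ≠ 1) :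
    IsMulCommutative (Subgroup.centralizer {x}) ∨ IsDihedral (Subgroup.centralizer {x}) := by
  obtain ⟨X, rfl⟩ := QuotientGroup.mk_surjective x
  by_cases h : X 0 0 + X 1 1 ≠ 0 ∨ (2 : F) = 0
  · refine .inl ⟨⟨fun a b => Subtype.ext ?_⟩⟩
    exact commute_of_commute_of_two_mul_trace_ne_zero ((mk_ne_one_iff X).1 hx) h
      (Subgroup.mem_centralizer_singleton_iff.1 a.2) (Subgroup.mem_centralizer_singleton_iff.1 b.2)
  · push Not at h
    exact isMulCommutative_or_isDihedral_of_trace_eq_zero h.2 h.1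

theorem isFSZPlus [Finite F] : IsFSZPlus (ProjectiveSpecialLinearGroup (Fin 2) F) := by
  refine isFSZPlus_of_centralizer fun g => ?_
  obtain ⟨X, rfl⟩ := QuotientGroup.mk_surjective g
  by_cases h1 : (QuotientGroup.mk X : ProjectiveSpecialLinearGroup (Fin 2) F) = 1
  · left
    rw [h1, one_pow]
  by_cases h : X 0 0 + X 1 1 = 0
  · left
    rw [sq, mk_mul_self_of_trace_eq_zero h]
  · exact .inr fun a b ha hb =>
      commute_of_commute_of_two_mul_trace_ne_zero ((mk_ne_one_iff X).1 h1) (.inl h) ha hb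

end Matrix.ProjectiveSpecialLinearGroup

end

theorem mainTheorem11 :
    -- finite abelian groups are `FSZ`
    (∀ (A : Type*) [CommGroup A] [Fintype A], IsFSZ A) ∧
    -- finite dihedral groups are `FSZ`
    (∀ (D : Type*) [Group D] [Fintype D], IsDihedral D → IsFSZ D) ∧
    -- for every finite field `F` with `q` elements, every nonidentity element of `PSL_2(q)` has an
    -- abelian or dihedral centralizer, and `PSL_2(q)` is `FSZ⁺`
    (∀ (F : Type*) [Field F] [Finite F],
      (∀ x : Matrix.ProjectiveSpecialLinearGroup (Fin 2) F, x ≠ 1 →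
        IsMulCommutative (Subgroup.centralizer {x}) ∨ IsDihedral (Subgroup.centralizer {x})) ∧
      IsFSZPlus (Matrix.ProjectiveSpecialLinearGroup (Fin 2) F)) :=
  ⟨fun A => isFSZ_of_commGroup A, fun D => isFSZ_of_isDihedral D, fun _ =>
    ⟨Matrix.ProjectiveSpecialLinearGroup.isMulCommutative_or_isDihedral_centralizer,
      Matrix.ProjectiveSpecialLinearGroup.isFSZPlus⟩⟩
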